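/- Let $k$ be a field and let $H$ be a pointed Hopf algebra over $k$, that is, a Hopf algebra whose coradical (the sum of all simple subcoalgebras) is the $k$-linear span of the group-like elements of $H$. A Hopf subalgebra of $H$ is a subalgebra $K$ with $\Delta(K)\subseteq K\otimes K$ that is stable under the antipode; an algebra is called affine if it is finitely generated as a $k$-algebra. Then the following two conditions on $H$ are equivalent: (i) every Hopf subalgebra of $H$ is affine; (ii) every ascending chain $K_0\subseteq K_1\subseteq K_2\subseteq\cdots$ of Hopf subalgebras of $H$ stabilizes. Moreover, if $H$ is right Noetherian or left Noetherian, then both conditions hold. -/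

import Mathlib

open scoped TensorProduct

section Coalgebra

variable (k : Type*) {C : Type*} [Field k] [AddCommGroup C] [Module k C] [Coalgebra k C]

/-- A subspace `D` of a coalgebra `C` is a subcoalgebra if `Δ(D) ⊆ D ⊗ D`, where `D ⊗ D` is
regarded as a subspace of `C ⊗ C`. -/
def IsSubcoalgebra (D : Submodule k C) : Prop :=
  ∀ x ∈ D, Coalgebra.comul (R := k) x ∈ LinearMap.range (TensorProduct.mapIncl D D)

/-- A simple subcoalgebra: a nonzero subcoalgebra whose only subcoalgebras are `0` and itself. -/
structure IsSimpleSubcoalgebra (D : Submodule k C) : Prop where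
  isSubcoalgebra : IsSubcoalgebra k D
  ne_bot : D ≠ ⊥
  eq_bot_or_eq : ∀ E : Submodule k C, IsSubcoalgebra k E → E ≤ D → E = ⊥ ∨ E = D

variable (C) in
/-- The coradical of a coalgebra: the sum of all its simple subcoalgebras. -/
def coradical : Submodule k C :=
  sSup {D : Submodule k C | IsSimpleSubcoalgebra k D}

variable (C) in
/-- A coalgebra is pointed if its coradical is the linear span of its group-like elements. -/
def IsPointedCoalgebra : Prop :=
  coradical k C = Submodule.span k {g : C | IsGroupLikeElem k g}

end Coalgebra

section Hopf

variable {k H : Type*} [Field k] [Ring H] [HopfAlgebra k H]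

/-- A subalgebra of a Hopf algebra is a Hopf subalgebra if it is a subcoalgebra that is stable
under the antipode. -/
structure IsHopfSubalgebra (K : Subalgebra k H) : Prop where
  isSubcoalgebra : IsSubcoalgebra k (Subalgebra.toSubmodule K)
  antipode_mem : ∀ x ∈ K, HopfAlgebra.antipode k x ∈ K

variable (k H) in
/-- Every Hopf subalgebra of `H` is affine, that is, finitely generated as a `k`-algebra. -/
def HopfSubalgebrasAffine : Prop :=
  ∀ K : Subalgebra k H, IsHopfSubalgebra K → Algebra.FiniteType k K

variable (k H) in
/-- Every ascending chain `K 0 ≤ K 1 ≤ ⋯` of Hopf subalgebras of `H` stabilizes. -/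
def HopfSubalgebrasACC : Prop :=
  ∀ K : ℕ → Subalgebra k H, (∀ n, IsHopfSubalgebra (K n)) → Monotone K →
    ∃ N, ∀ n, N ≤ n → K n = K N

end Hopf

/-! The heart is that a Hopf subalgebra `K` of a pointed `H` is a direct summand of `H` as a left
`K`-module, with `1` sent to `1` by the projection `p`. Pointedness gives, in any nonzero quotient
of left coideals, the class of some `x` with `Δ(x) ≡ g ⊗ x` for a group-like `g`. If `M` is also a
left `K`-module and `x ∉ M`, such an `x` generates a free `K`-module modulo `M`, so a complement of
`K` can be enlarged step by step (Zorn).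

Convolving `p` with the antipode recovers `K` from the right ideal `K⁺H`, and likewise from the left
ideal `HK⁺` (`K⁺` is the kernel of the counit on `K`). Both assignments are monotone and reflect
inclusion, so a one-sided Noetherian `H` has the chain condition on Hopf subalgebras.

For the equivalence, affineness of the union of a chain puts its generators in one term. Conversely,
each element of `K` lies in an affine Hopf subalgebra of `K`: generate by a finite-dimensional
subcoalgebra and the inverses of its finitely many group-likes. A maximal affine Hopf subalgebra of
`K` is then all of `K`. -/

/-! ### Slices of tensors. -/

section Slices

variable {k M N : Type*} [Field k] [AddCommGroup M] [Module k M] [AddCommGroup N] [Module k N]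

/-- Contraction of the left tensor factor with a functional. -/
noncomputable def leftSlice (f : Module.Dual k M) : M ⊗[k] N →ₗ[k] N :=
  (TensorProduct.lid k N).toLinearMap ∘ₗ f.rTensor N

/-- Contraction of the right tensor factor with a functional. -/
noncomputable def rightSlice (φ : Module.Dual k N) : M ⊗[k] N →ₗ[k] M :=
  (TensorProduct.rid k M).toLinearMap ∘ₗ φ.lTensor M

@[simp] lemma leftSlice_tmul (f : Module.Dual k M) (m : M) (n : N) :
    leftSlice f (m ⊗ₜ[k] n) = f m • n := by simp [leftSlice]

@[simp] lemma rightSlice_tmul (φ : Module.Dual k N) (m : M) (n : N) :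
    rightSlice φ (m ⊗ₜ[k] n) = φ n • m := by simp [rightSlice]

lemma apply_leftSlice_eq_apply_rightSlice (f : Module.Dual k M) (φ : Module.Dual k N)
    (t : M ⊗[k] N) : φ (leftSlice f t) = f (rightSlice φ t) := by
  induction t with
  | zero => simp
  | tmul m n => simp [mul_comm]
  | add s t hs ht => simp [hs, ht]

/-- Expanding `t` along a basis of `M`, the coefficients in `N` are the slices by the coordinate
functionals. -/
lemma mem_range_lTensor_of_leftSlice_mem {Q : Submodule k N} {t : M ⊗[k] N}
    (h : ∀ f : Module.Dual k M, leftSlice f t ∈ Q) :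
    t ∈ LinearMap.range (Q.subtype.lTensor M) := by
  classical
  let b := Module.Basis.ofVectorSpace k M
  rw [← (TensorProduct.equivFinsuppOfBasisLeft (N := N) b).symm_apply_apply t,
    TensorProduct.equivFinsuppOfBasisLeft_symm_apply]
  refine Submodule.finsuppSum_mem _ _ _ _ fun i _ ↦ ?_
  have hi : TensorProduct.equivFinsuppOfBasisLeft b t i ∈ Q := by
    rw [TensorProduct.equivFinsuppOfBasisLeft_apply]
    exact h _
  exact ⟨b i ⊗ₜ ⟨_, hi⟩, by simp⟩

lemma mem_range_rTensor_of_rightSlice_mem {P : Submodule k M} {t : M ⊗[k] N}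
    (h : ∀ φ : Module.Dual k N, rightSlice φ t ∈ P) :
    t ∈ LinearMap.range (P.subtype.rTensor N) := by
  classical
  let b := Module.Basis.ofVectorSpace k N
  rw [← (TensorProduct.equivFinsuppOfBasisRight (M := M) b).symm_apply_apply t,
    TensorProduct.equivFinsuppOfBasisRight_symm_apply]
  refine Submodule.finsuppSum_mem _ _ _ _ fun i _ ↦ ?_
  have hi : TensorProduct.equivFinsuppOfBasisRight b t i ∈ P := by
    rw [TensorProduct.equivFinsuppOfBasisRight_apply]
    exact h _
  exact ⟨⟨_, hi⟩ ⊗ₜ b i, by simp⟩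

lemma range_mapIncl_induction {P : Submodule k M} {Q : Submodule k N} {p : M ⊗[k] N → Prop}
    (zero : p 0) (tmul : ∀ m ∈ P, ∀ n ∈ Q, p (m ⊗ₜ n)) (add : ∀ s t, p s → p t → p (s + t))
    {t : M ⊗[k] N} (ht : t ∈ LinearMap.range (TensorProduct.mapIncl P Q)) : p t := by
  obtain ⟨t, rfl⟩ := ht
  induction t with
  | zero => simpa using zero
  | tmul m n => simpa [TensorProduct.mapIncl] using tmul m m.2 n n.2
  | add s t hs ht => simpa using add _ _ hs ht

/-- Membership in `P ⊗ Q` is detected by slices. -/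
lemma mem_range_mapIncl_iff {P : Submodule k M} {Q : Submodule k N} {t : M ⊗[k] N} :
    t ∈ LinearMap.range (TensorProduct.mapIncl P Q) ↔
      (∀ f : Module.Dual k M, leftSlice f t ∈ Q) ∧
        ∀ φ : Module.Dual k N, rightSlice φ t ∈ P := by
  constructor
  · refine range_mapIncl_induction (p := fun t ↦ (∀ f : Module.Dual k M, leftSlice f t ∈ Q) ∧
        ∀ φ : Module.Dual k N, rightSlice φ t ∈ P) (by simp) (fun m hm n hn ↦ ?_) ?_
    · exact ⟨fun f ↦ by simpa using Q.smul_mem _ hn, fun φ ↦ by simpa using P.smul_mem _ hm⟩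
    · rintro s t ⟨hs, hs'⟩ ⟨ht, ht'⟩
      exact ⟨fun f ↦ by simpa using Q.add_mem (hs f) (ht f),
        fun φ ↦ by simpa using P.add_mem (hs' φ) (ht' φ)⟩
  · rintro ⟨h, h'⟩
    obtain ⟨t, rfl⟩ := mem_range_lTensor_of_leftSlice_mem h
    have key : ∀ (φ : Module.Dual k N) (t : M ⊗[k] Q),
        rightSlice φ (Q.subtype.lTensor M t) = rightSlice (φ ∘ₗ Q.subtype) t := fun φ t ↦ by
      induction t with
      | zero => simp
      | tmul m n => simp
      | add s t hs ht => simp [hs, ht]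
    have ht : t ∈ LinearMap.range (P.subtype.rTensor Q) := by
      refine mem_range_rTensor_of_rightSlice_mem fun φ ↦ ?_
      -- Functionals on `Q` extend to `N`, so slices taken inside `M ⊗ Q` are slices of the original
      -- tensor.
      obtain ⟨ψ, rfl⟩ := LinearMap.exists_extend φ
      rw [← key]
      exact h' _
    obtain ⟨t, rfl⟩ := ht
    refine ⟨t, ?_⟩
    rw [TensorProduct.mapIncl, ← LinearMap.comp_apply, LinearMap.lTensor_comp_rTensor]

lemma range_mapIncl_mono {P P' : Submodule k M} {Q Q' : Submodule k N} (hP : P ≤ P')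
    (hQ : Q ≤ Q') : LinearMap.range (TensorProduct.mapIncl P Q) ≤
      LinearMap.range (TensorProduct.mapIncl P' Q') := fun t ht ↦ by
  rw [mem_range_mapIncl_iff] at ht ⊢
  exact ⟨fun f ↦ hQ (ht.1 f), fun φ ↦ hP (ht.2 φ)⟩

end Slices

/-! ### The dual acting on a coalgebra; local finiteness. -/

section Hits

open Coalgebra

variable {k C : Type*} [Field k] [AddCommGroup C] [Module k C] [Coalgebra k C]

variable (k C) in
/-- The left hit action `f ↦ (x ↦ f(x₁) x₂)`. -/
noncomputable def leftHit : Module.Dual k C →ₗ[k] Module.End k C where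
  toFun f := leftSlice f ∘ₗ comul
  map_add' f g := by ext; simp [leftSlice, LinearMap.rTensor_add]
  map_smul' r f := by ext; simp [leftSlice, LinearMap.rTensor_smul]

variable (k C) in
/-- The right hit action `φ ↦ (x ↦ x₁ φ(x₂))`. -/
noncomputable def rightHit : Module.Dual k C →ₗ[k] Module.End k C where
  toFun φ := rightSlice φ ∘ₗ comul
  map_add' f g := by ext; simp [rightSlice, LinearMap.lTensor_add]
  map_smul' r f := by ext; simp [rightSlice, LinearMap.lTensor_smul]

lemma leftHit_apply (f : Module.Dual k C) (x : C) : leftHit k C f x = leftSlice f (comul x) := rfl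

lemma rightHit_apply (φ : Module.Dual k C) (x : C) :
    rightHit k C φ x = rightSlice φ (comul x) := rfl

@[simp] lemma leftHit_counit (x : C) : leftHit k C counit x = x := by
  simp [leftHit_apply, leftSlice]

@[simp] lemma rightHit_counit (x : C) : rightHit k C counit x = x := by
  simp [rightHit_apply, rightSlice]

/-- Both sides are `f(x₁) φ(x₂)`. This adjointness turns membership questions about one action into
vanishing of functionals on the other. -/
lemma apply_leftHit (f φ : Module.Dual k C) (x : C) :
    φ (leftHit k C f x) = f (rightHit k C φ x) :=
  apply_leftSlice_eq_apply_rightSlice _ _ _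

@[simp] lemma counit_leftHit (f : Module.Dual k C) (x : C) :
    counit (R := k) (leftHit k C f x) = f x := by
  rw [apply_leftHit, rightHit_counit]

@[simp] lemma counit_rightHit (φ : Module.Dual k C) (x : C) :
    counit (R := k) (rightHit k C φ x) = φ x := by
  rw [← apply_leftHit, leftHit_counit]

/-- Coassociativity: both sides are `f(x₁) x₂ φ(x₃)`. -/
lemma leftHit_rightHit (f φ : Module.Dual k C) (x : C) :
    leftHit k C f (rightHit k C φ x) = rightHit k C φ (leftHit k C f x) := by
  have h1 : ∀ t : C ⊗[k] C, leftHit k C f (rightSlice φ t) =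
      leftSlice f ((rightSlice φ).lTensor C
        (TensorProduct.assoc k C C C (comul.rTensor C t))) := fun t ↦ by
    induction t with
    | zero => simp
    | add s t hs ht => simp [hs, ht]
    | tmul a b =>
      rw [rightSlice_tmul, map_smul, LinearMap.rTensor_tmul, leftHit_apply]
      induction comul (R := k) a with
      | zero => simp
      | add s t hs ht => simp only [TensorProduct.add_tmul, map_add, smul_add, hs, ht]
      | tmul c d => simp [smul_smul, mul_comm]
  have h2 : ∀ t : C ⊗[k] C, rightHit k C φ (leftSlice f t) =
      leftSlice f ((rightSlice φ).lTensor C (comul.lTensor C t)) := fun t ↦ by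
    induction t with
    | zero => simp
    | add s t hs ht => simp [hs, ht]
    | tmul a b => simp [rightHit_apply]
  rw [rightHit_apply, h1, coassoc_apply, ← h2, leftHit_apply]

lemma leftHit_leftHit (f g : Module.Dual k C) (x : C) :
    leftHit k C f (leftHit k C g x) = leftHit k C (f ∘ₗ leftHit k C g) x := by
  rw [← sub_eq_zero, ← Module.forall_dual_apply_eq_zero_iff k]
  intro φ
  rw [map_sub, sub_eq_zero, apply_leftHit, apply_leftHit, ← leftHit_rightHit]
  rfl

lemma rightHit_rightHit (φ ψ : Module.Dual k C) (x : C) :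
    rightHit k C φ (rightHit k C ψ x) = rightHit k C (φ ∘ₗ rightHit k C ψ) x := by
  rw [← sub_eq_zero, ← Module.forall_dual_apply_eq_zero_iff k]
  intro f
  rw [map_sub, sub_eq_zero, ← apply_leftHit, ← apply_leftHit, leftHit_rightHit]
  rfl

lemma IsGroupLikeElem.leftHit_eq_smul {g : C} (hg : IsGroupLikeElem k g) (f : Module.Dual k C) :
    leftHit k C f g = f g • g := by
  rw [leftHit_apply, hg.comul_eq_tmul_self, leftSlice_tmul]

lemma IsSubcoalgebra.leftHit_mem {D : Submodule k C} (hD : IsSubcoalgebra k D)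
    (f : Module.Dual k C) {x : C} (hx : x ∈ D) : leftHit k C f x ∈ D :=
  (mem_range_mapIncl_iff.1 (hD x hx)).1 f

lemma IsSubcoalgebra.rightHit_mem {D : Submodule k C} (hD : IsSubcoalgebra k D)
    (f : Module.Dual k C) {x : C} (hx : x ∈ D) : rightHit k C f x ∈ D :=
  (mem_range_mapIncl_iff.1 (hD x hx)).2 f

lemma isSubcoalgebra_of_hit_mem {D : Submodule k C}
    (hl : ∀ f : Module.Dual k C, ∀ x ∈ D, leftHit k C f x ∈ D)
    (hr : ∀ f : Module.Dual k C, ∀ x ∈ D, rightHit k C f x ∈ D) : IsSubcoalgebra k D :=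
  fun x hx ↦ mem_range_mapIncl_iff.2 ⟨fun f ↦ hl f x hx, fun f ↦ hr f x hx⟩

lemma leftSlice_comul_mem_finite (x : C) : ∃ U : Submodule k C, Module.Finite k U ∧
    ∀ f : Module.Dual k C, leftHit k C f x ∈ U := by
  have h : ∀ t : C ⊗[k] C, ∃ U : Submodule k C, Module.Finite k U ∧
      ∀ f : Module.Dual k C, leftSlice f t ∈ U := fun t ↦ by
    induction t with
    | zero => exact ⟨⊥, inferInstance, by simp⟩
    | tmul a b => exact ⟨k ∙ b, inferInstance, fun f ↦ by
        simpa using Submodule.smul_mem _ _ (Submodule.mem_span_singleton_self b)⟩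
    | add s t hs ht =>
      obtain ⟨U, _, hU⟩ := hs
      obtain ⟨V, _, hV⟩ := ht
      exact ⟨U ⊔ V, inferInstance, fun f ↦ by
        simpa using Submodule.add_mem_sup (hU f) (hV f)⟩
  exact h _

lemma rightSlice_comul_mem_finite (x : C) : ∃ U : Submodule k C, Module.Finite k U ∧
    ∀ f : Module.Dual k C, rightHit k C f x ∈ U := by
  have h : ∀ t : C ⊗[k] C, ∃ U : Submodule k C, Module.Finite k U ∧
      ∀ f : Module.Dual k C, rightSlice f t ∈ U := fun t ↦ by
    induction t with
    | zero => exact ⟨⊥, inferInstance, by simp⟩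
    | tmul a b => exact ⟨k ∙ a, inferInstance, fun f ↦ by
        simpa using Submodule.smul_mem _ _ (Submodule.mem_span_singleton_self a)⟩
    | add s t hs ht =>
      obtain ⟨U, _, hU⟩ := hs
      obtain ⟨V, _, hV⟩ := ht
      exact ⟨U ⊔ V, inferInstance, fun f ↦ by
        simpa using Submodule.add_mem_sup (hU f) (hV f)⟩
  exact h _

/-- Every element of a coalgebra lies in a finite-dimensional subcoalgebra. -/
theorem exists_finite_subcoalgebra (x : C) : ∃ D : Submodule k C, IsSubcoalgebra k D ∧
    Module.Finite k D ∧ x ∈ D := by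
  -- The middle factors `f(x₁) x₂ φ(x₃)` of the iterated coproduct; `f = φ = ε` gives `x` itself.
  let T : Set C := {y | ∃ f φ : Module.Dual k C, y = leftHit k C f (rightHit k C φ x)}
  refine ⟨Submodule.span k T, ?_, ?_, Submodule.subset_span ⟨counit, counit, by simp⟩⟩
  · refine isSubcoalgebra_of_hit_mem (fun f y hy ↦ ?_) fun f y hy ↦ ?_
    · induction hy using Submodule.span_induction with
      | mem y hy =>
        obtain ⟨g, φ, rfl⟩ := hy
        exact Submodule.subset_span ⟨_, φ, leftHit_leftHit _ _ _⟩
      | zero => simp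
      | add y z _ _ hy hz => simpa using add_mem hy hz
      | smul r y _ hy => simpa using Submodule.smul_mem _ r hy
    · induction hy using Submodule.span_induction with
      | mem y hy =>
        obtain ⟨g, φ, rfl⟩ := hy
        exact Submodule.subset_span ⟨g, f ∘ₗ rightHit k C φ, by
          rw [← leftHit_rightHit, rightHit_rightHit]⟩
      | zero => simp
      | add y z _ _ hy hz => simpa using add_mem hy hz
      | smul r y _ hy => simpa using Submodule.smul_mem _ r hy
  · obtain ⟨U, hU, hxU⟩ := rightSlice_comul_mem_finite (k := k) x
    obtain ⟨s, rfl⟩ := Module.Finite.iff_fg.1 hU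
    choose V hV hxV using leftSlice_comul_mem_finite (k := k) (C := C)
    have : Module.Finite k (⨆ u : s, V u : Submodule k C) := inferInstance
    refine Submodule.finiteDimensional_of_le (S₂ := ⨆ u : s, V u) (Submodule.span_le.2 ?_)
    rintro _ ⟨f, φ, rfl⟩
    have : ∀ u ∈ Submodule.span k (s : Set C), leftHit k C f u ∈ (⨆ u : s, V u) := fun u hu ↦ by
      induction hu using Submodule.span_induction with
      | mem u hu => exact Submodule.mem_iSup_of_mem (⟨u, hu⟩ : s) (hxV u f)
      | zero => simp
      | add y z _ _ hy hz => simpa using add_mem hy hz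
      | smul r y _ hy => simpa using Submodule.smul_mem _ r hy
    exact this _ (hxU φ)

variable (k C) in
/-- The algebra of left hit operators; its submodules are the left coideals. -/
noncomputable def hitAlgebra : Subalgebra k (Module.End k C) where
  carrier := Set.range (leftHit k C)
  mul_mem' := by
    rintro _ _ ⟨f, rfl⟩ ⟨g, rfl⟩
    exact ⟨f ∘ₗ leftHit k C g, by ext x; simp [leftHit_leftHit]⟩
  add_mem' := by
    rintro _ _ ⟨f, rfl⟩ ⟨g, rfl⟩
    exact ⟨f + g, map_add _ _ _⟩
  algebraMap_mem' r := ⟨r • counit, by ext x; simp [Module.algebraMap_end_apply]⟩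

lemma leftHit_mem_of_mem (M : Submodule (hitAlgebra k C) C) (f : Module.Dual k C) {x : C}
    (hx : x ∈ M) : leftHit k C f x ∈ M :=
  M.smul_mem (⟨leftHit k C f, f, rfl⟩ : hitAlgebra k C) hx

/-- A subspace closed under the left hit operators, as a module. -/
def leftCoideal (D : Submodule k C) (h : ∀ f : Module.Dual k C, ∀ x ∈ D, leftHit k C f x ∈ D) :
    Submodule (hitAlgebra k C) C where
  __ := D
  smul_mem' := by
    rintro ⟨_, f, rfl⟩ x hx
    exact h f x hx

@[simp] lemma mem_leftCoideal {D : Submodule k C}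
    {h : ∀ f : Module.Dual k C, ∀ x ∈ D, leftHit k C f x ∈ D} {x : C} :
    x ∈ leftCoideal D h ↔ x ∈ D := Iff.rfl

end Hits

/-! ### Simple subcomodules of quotients of left coideals. -/

section Socle

open Coalgebra

variable {k C : Type*} [Field k] [AddCommGroup C] [Module k C] [Coalgebra k C]

/-- For a functional `φ` vanishing on the left coideal `M`, the map `C ⧸ M → C` induced by
`x ↦ x₁ φ(x₂)`. -/
noncomputable def coeffMap (M : Submodule (hitAlgebra k C) C) (φ : Module.Dual k C)
    (hφ : ∀ m ∈ M, φ m = 0) : (C ⧸ M) →ₗ[hitAlgebra k C] C :=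
  M.liftQ
    { toFun := rightHit k C φ
      map_add' := map_add _
      map_smul' := by
        rintro ⟨_, f, rfl⟩ x
        exact (leftHit_rightHit f φ x).symm }
    fun m hm ↦ by
      rw [LinearMap.mem_ker, LinearMap.coe_mk, AddHom.coe_mk,
        ← Module.forall_dual_apply_eq_zero_iff k]
      intro f
      rw [← apply_leftHit]
      exact hφ _ (leftHit_mem_of_mem M f hm)

lemma coeffMap_mk (M : Submodule (hitAlgebra k C) C) (φ : Module.Dual k C)
    (hφ : ∀ m ∈ M, φ m = 0) (x : C) :
    coeffMap M φ hφ (Submodule.Quotient.mk x) = rightHit k C φ x := rfl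

lemma exists_dual_vanishing_of_notMem (M : Submodule (hitAlgebra k C) C) {x : C} (hx : x ∉ M) :
    ∃ φ : Module.Dual k C, φ x ≠ 0 ∧ ∀ m ∈ M, φ m = 0 := by
  obtain ⟨φ, h, hM⟩ := Submodule.exists_le_ker_of_notMem (p := M.restrictScalars k) (v := x) hx
  exact ⟨φ, h, fun m hm ↦ hM hm⟩

/-- The coefficient space of a subcomodule `W` of `C ⧸ M`. -/
noncomputable def coeffSpace (M : Submodule (hitAlgebra k C) C)
    (W : Submodule (hitAlgebra k C) (C ⧸ M)) : Submodule (hitAlgebra k C) C :=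
  ⨆ φ : {φ : Module.Dual k C // ∀ m ∈ M, φ m = 0}, W.map (coeffMap M φ.1 φ.2)

/-- Right hits compose to right hits, and `ψ ∘ rightHit φ` still vanishes on the left coideal `M`,
so right hits only permute the defining images among themselves up to inclusion. -/
lemma isSubcoalgebra_coeffSpace (M : Submodule (hitAlgebra k C) C)
    (W : Submodule (hitAlgebra k C) (C ⧸ M)) :
    IsSubcoalgebra k ((coeffSpace M W).restrictScalars k) := by
  refine isSubcoalgebra_of_hit_mem (fun f x hx ↦ leftHit_mem_of_mem _ f hx) fun ψ x hx ↦ ?_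
  rw [Submodule.restrictScalars_mem] at hx ⊢
  refine Submodule.iSup_induction _ (motive := fun x ↦ rightHit k C ψ x ∈ coeffSpace M W) hx
    ?_ (by simp) fun x y hx hy ↦ by simpa using add_mem hx hy
  rintro ⟨φ, hφ⟩ _ ⟨w, hw, rfl⟩
  have hφ' : ∀ m ∈ M, (ψ ∘ₗ rightHit k C φ) m = 0 := fun m hm ↦ by
    rw [LinearMap.comp_apply, ← apply_leftHit]
    exact hφ _ (leftHit_mem_of_mem M _ hm)
  refine Submodule.mem_iSup_of_mem ⟨_, hφ'⟩ ⟨w, hw, ?_⟩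
  obtain ⟨v, rfl⟩ := Submodule.Quotient.mk_surjective _ w
  rw [coeffMap_mk, coeffMap_mk, rightHit_rightHit]

/-- Since `ε(v₁ φ(v₂)) = φ(v)`, any functional separating `v` from `M` works. -/
lemma exists_coeffMap_ne_zero (M : Submodule (hitAlgebra k C) C)
    (W : Submodule (hitAlgebra k C) (C ⧸ M)) (hW : W ≠ ⊥) :
    ∃ φ, ∃ hφ : ∀ m ∈ M, φ m = 0, coeffMap M φ hφ ∘ₗ W.subtype ≠ 0 := by
  obtain ⟨w, hw, hw0⟩ := W.ne_bot_iff.1 hW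
  obtain ⟨v, rfl⟩ := Submodule.Quotient.mk_surjective _ w
  obtain ⟨φ, hv, hφ⟩ := exists_dual_vanishing_of_notMem M
    (x := v) (by rwa [ne_eq, Submodule.Quotient.mk_eq_zero] at hw0)
  refine ⟨φ, hφ, fun h ↦ hv ?_⟩
  have := LinearMap.congr_fun h ⟨_, hw⟩
  rw [LinearMap.comp_apply, Submodule.subtype_apply, coeffMap_mk, LinearMap.zero_apply] at this
  rw [← counit_rightHit, this, map_zero]

lemma coeffSpace_le_isotypicComponent (M : Submodule (hitAlgebra k C) C)
    (W : Submodule (hitAlgebra k C) (C ⧸ M)) [IsSimpleModule (hitAlgebra k C) W] :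
    coeffSpace M W ≤ isotypicComponent (hitAlgebra k C) C W := by
  refine iSup_le fun φ ↦ ?_
  have h := Submodule.map_le_isotypicComponent W (coeffMap M φ.1 φ.2)
  exact h

/-- The coefficient space of a simple comodule is a simple subcoalgebra. -/
theorem isSimpleSubcoalgebra_coeffSpace (M : Submodule (hitAlgebra k C) C)
    (W : Submodule (hitAlgebra k C) (C ⧸ M)) [IsSimpleModule (hitAlgebra k C) W] :
    IsSimpleSubcoalgebra k ((coeffSpace M W).restrictScalars k) where
  isSubcoalgebra := isSubcoalgebra_coeffSpace M W
  ne_bot h := by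
    have hW : W ≠ ⊥ := (isSimpleModule_iff_isAtom.1 ‹_›).1
    obtain ⟨φ, hφ, h0⟩ := exists_coeffMap_ne_zero M W hW
    refine h0 (LinearMap.ext fun w ↦ ?_)
    have : coeffMap M φ hφ w ∈ (coeffSpace M W).restrictScalars k :=
      Submodule.mem_iSup_of_mem (p := fun φ : {φ : Module.Dual k C // ∀ m ∈ M, φ m = 0} ↦
        W.map (coeffMap M φ.1 φ.2)) ⟨φ, hφ⟩ ⟨w, w.2, rfl⟩
    rwa [h, Submodule.mem_bot] at this
  eq_bot_or_eq E hE hEC := by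
    refine or_iff_not_imp_left.2 fun hE0 ↦ le_antisymm hEC ?_
    let E' := leftCoideal E fun f x hx ↦ hE.leftHit_mem f hx
    have hE' : E' ≤ isotypicComponent (hitAlgebra k C) C W :=
      fun x hx ↦ coeffSpace_le_isotypicComponent M W (hEC hx)
    have : IsSemisimpleModule (hitAlgebra k C) E' :=
      IsSemisimpleModule.of_injective (N := E') (M := isotypicComponent (hitAlgebra k C) C W)
        (Submodule.inclusion hE') (Submodule.inclusion_injective hE')
    obtain h | ⟨T, hTE, hT⟩ := IsSemisimpleModule.eq_bot_or_exists_simple_le E'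
    · refine absurd ?_ hE0
      rw [Submodule.eq_bot_iff] at h ⊢
      exact h
    -- `E` lies in the `W`-isotypic part, so its simple submodule `T` is isomorphic to `W`.
    have : ∀ m : {m : Submodule (hitAlgebra k C) C | Nonempty (m ≃ₗ[hitAlgebra k C] W)},
        IsSimpleModule (hitAlgebra k C) m := fun ⟨m, ⟨e⟩⟩ ↦ .congr e
    obtain ⟨S, ⟨e'⟩, ⟨e⟩⟩ := T.linearEquiv_of_le_sSup _ (hTE.trans hE')
    let ψ : W ≃ₗ[hitAlgebra k C] T := (e.trans e').symm
    -- A functional vanishing on `E` acts as zero on `T ≤ E`, hence on `W`; by adjointness it then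
    -- vanishes on all coefficients of `W`.
    have key : ∀ f : Module.Dual k C, (∀ x ∈ E, f x = 0) →
        ∀ w ∈ W, (⟨leftHit k C f, f, rfl⟩ : hitAlgebra k C) • w = 0 := fun f hf w hw ↦ by
      have h1 : (⟨leftHit k C f, f, rfl⟩ : hitAlgebra k C) • (ψ ⟨w, hw⟩) = 0 := by
        apply Subtype.ext
        change leftHit k C f (ψ ⟨w, hw⟩ : C) = 0
        rw [← Module.forall_dual_apply_eq_zero_iff k]
        intro φ
        rw [apply_leftHit]
        exact hf _ (hE.rightHit_mem φ (hTE (ψ ⟨w, hw⟩).2))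
      rw [← map_smul, LinearEquiv.map_eq_zero_iff] at h1
      exact congrArg Subtype.val h1
    intro x hx
    by_contra hxE
    obtain ⟨f, hfx, hf⟩ := Submodule.exists_le_ker_of_notMem hxE
    refine hfx ?_
    refine Submodule.iSup_induction _ (motive := fun x ↦ f x = 0) hx ?_ (by simp)
      fun x y hx hy ↦ by simp [hx, hy]
    rintro ⟨φ, hφ⟩ _ ⟨w, hw, rfl⟩
    have h2 := key f (fun x hx ↦ hf hx) w hw
    obtain ⟨v, rfl⟩ := Submodule.Quotient.mk_surjective _ w
    rw [coeffMap_mk, ← apply_leftHit]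
    exact hφ _ ((Submodule.Quotient.mk_eq_zero M).1 h2)

lemma IsGroupLikeElem.isSimpleModule_span {g : C} (hg : IsGroupLikeElem k g) :
    IsSimpleModule (hitAlgebra k C) (Submodule.span (hitAlgebra k C) {g}) := by
  rw [isSimpleModule_iff_isAtom]
  refine ⟨by simpa using hg.ne_zero, fun N hN ↦ ?_⟩
  by_contra h
  obtain ⟨x, hx, hx0⟩ := N.ne_bot_iff.1 h
  obtain ⟨⟨_, f, rfl⟩, rfl⟩ := Submodule.mem_span_singleton.1 (hN.le hx)
  refine hN.not_ge ((Submodule.span_singleton_le_iff_mem _ _).2 ?_)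
  change leftHit k C f g ∈ N at hx
  change leftHit k C f g ≠ 0 at hx0
  rw [hg.leftHit_eq_smul] at hx hx0
  have := (N.restrictScalars k).smul_mem (f g)⁻¹ hx
  rwa [inv_smul_smul₀ (left_ne_zero_of_smul hx0)] at this

/-- Local finiteness: a cyclic left coideal is finite-dimensional, so its nonzero image in the
quotient is Artinian and contains a simple module. -/
lemma exists_isSimpleModule_le_map_mkQ (M L : Submodule (hitAlgebra k C) C) (hLM : ¬ L ≤ M) :
    ∃ W : Submodule (hitAlgebra k C) (C ⧸ M), IsSimpleModule (hitAlgebra k C) W ∧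
      W ≤ L.map M.mkQ := by
  obtain ⟨x, hxL, hxM⟩ := SetLike.not_le_iff_exists.1 hLM
  let V := Submodule.span (hitAlgebra k C) {x}
  have hV : Module.Finite k (V.restrictScalars k) := by
    obtain ⟨U, _, hU⟩ := leftSlice_comul_mem_finite (k := k) x
    refine Submodule.finiteDimensional_of_le (S₁ := V.restrictScalars k) (S₂ := U) fun y hy ↦ ?_
    obtain ⟨⟨_, f, rfl⟩, rfl⟩ := Submodule.mem_span_singleton.1 hy
    exact hU f
  have : IsArtinian (hitAlgebra k C) V := isArtinian_of_tower k
    (inferInstanceAs (IsArtinian k (V.restrictScalars k)))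
  have : IsArtinian (hitAlgebra k C) (V.map M.mkQ) :=
    isArtinian_of_surjective V (M.mkQ.submoduleMap V) (M.mkQ.submoduleMap_surjective V)
  have hx0 : V.map M.mkQ ≠ ⊥ := fun h ↦ hxM <| by
    have : M.mkQ x ∈ V.map M.mkQ := ⟨x, Submodule.mem_span_singleton_self x, rfl⟩
    rwa [h, Submodule.mem_bot, Submodule.mkQ_apply, Submodule.Quotient.mk_eq_zero] at this
  have : Nontrivial (V.map M.mkQ) := Submodule.nontrivial_iff_ne_bot.2 hx0
  obtain ⟨T, hT⟩ := IsAtomic.exists_atom (Submodule (hitAlgebra k C) (V.map M.mkQ))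
  have := isSimpleModule_iff_isAtom.2 hT
  refine ⟨T.map (Submodule.subtype _),
    .congr (N := T) (T.equivMapOfInjective _ (Submodule.subtype_injective _)).symm, ?_⟩
  exact (Submodule.map_subtype_le _ _).trans
    (Submodule.map_mono ((Submodule.span_singleton_le_iff_mem _ _).2 hxL))

/-- In a pointed coalgebra, every nonzero quotient of left coideals contains a one-dimensional
subcomodule. -/
theorem IsPointedCoalgebra.exists_leftHit_sub_smul_mem (hC : IsPointedCoalgebra k C)
    (M L : Submodule (hitAlgebra k C) C) (hLM : ¬ L ≤ M) :
    ∃ x ∈ L, x ∉ M ∧ ∃ g : C, IsGroupLikeElem k g ∧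
      ∀ f : Module.Dual k C, leftHit k C f x - f g • x ∈ M := by
  obtain ⟨W, hWs, hWL⟩ := exists_isSimpleModule_le_map_mkQ M L hLM
  have hW : W ≠ ⊥ := (isSimpleModule_iff_isAtom.1 ‹_›).1
  obtain ⟨φ, hφ, h0⟩ := exists_coeffMap_ne_zero M W hW
  let Φ := coeffMap M φ hφ ∘ₗ W.subtype
  have hΦ : Function.Injective Φ := LinearMap.injective_of_ne_zero h0
  let T := LinearMap.range Φ
  let e : W ≃ₗ[hitAlgebra k C] T := LinearEquiv.ofInjective Φ hΦ
  have hTs : IsSimpleModule (hitAlgebra k C) T := .congr e.symm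
  let s : Set (Submodule (hitAlgebra k C) C) :=
    (fun g ↦ Submodule.span (hitAlgebra k C) {g}) '' {g | IsGroupLikeElem k g}
  have hs : ∀ m : s, IsSimpleModule (hitAlgebra k C) m := by
    rintro ⟨_, g, hg, rfl⟩
    exact hg.isSimpleModule_span
  -- The copy `T` of `W` lies in a simple subcoalgebra, hence in the coradical, which is a sum of
  -- the lines `k g`; being simple, it is isomorphic to one of them.
  have hT : T ≤ sSup s := by
    rintro _ ⟨w, rfl⟩
    have h1 : Φ w ∈ coradical k C := (le_sSup (isSimpleSubcoalgebra_coeffSpace M W) :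
      (coeffSpace M W).restrictScalars k ≤ coradical k C)
      (Submodule.mem_iSup_of_mem (p := fun φ : {φ : Module.Dual k C // ∀ m ∈ M, φ m = 0} ↦
        W.map (coeffMap M φ.1 φ.2)) ⟨φ, hφ⟩ ⟨w, w.2, rfl⟩)
    rw [hC] at h1
    have h2 : Submodule.span k {g : C | IsGroupLikeElem k g} ≤ (sSup s).restrictScalars k :=
      Submodule.span_le.2 fun g hg ↦ (le_sSup ⟨g, hg, rfl⟩ :
        Submodule.span (hitAlgebra k C) {g} ≤ sSup s) (Submodule.mem_span_singleton_self g)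
    exact h2 h1
  obtain ⟨_, ⟨g, hg, rfl⟩, ⟨e'⟩⟩ := T.linearEquiv_of_le_sSup s hT
  let γ : Submodule.span (hitAlgebra k C) {g} := ⟨g, Submodule.mem_span_singleton_self g⟩
  let w : W := (e.trans e').symm γ
  have hw0 : (w : C ⧸ M) ≠ 0 := by
    rw [ne_eq, ZeroMemClass.coe_eq_zero, LinearEquiv.map_eq_zero_iff]
    exact fun h ↦ hg.ne_zero (congrArg Subtype.val h)
  obtain ⟨x, hxL, hx⟩ := hWL w.2
  refine ⟨x, hxL, fun h ↦ hw0 ?_, g, hg, fun f ↦ ?_⟩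
  · rw [← hx]
    exact (Submodule.Quotient.mk_eq_zero M).2 h
  · have h1 : (⟨leftHit k C f, f, rfl⟩ : hitAlgebra k C) • γ =
        (algebraMap k (hitAlgebra k C) (f g)) • γ := by
      apply Subtype.ext
      change leftHit k C f g = algebraMap k (Module.End k C) (f g) g
      rw [hg.leftHit_eq_smul, Module.algebraMap_end_apply]
    have h2 := congrArg (fun v ↦ ((e.trans e').symm v : C ⧸ M)) h1
    simp only [map_smul, Submodule.coe_smul] at h2
    change _ • (w : C ⧸ M) = _ • (w : C ⧸ M) at h2
    rw [← hx, ← map_smul, ← map_smul, ← sub_eq_zero, ← map_sub] at h2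
    have h3 := (Submodule.Quotient.mk_eq_zero M).1 h2
    rwa [algebraMap_smul] at h3

end Socle

/-! ### Splitting off a Hopf subalgebra. -/

section Retraction

open Coalgebra HopfAlgebra

variable {k H : Type*} [Field k] [Ring H] [HopfAlgebra k H]

lemma leftSlice_tmul_mul (f : Module.Dual k H) (b c : H) (s : H ⊗[k] H) :
    leftSlice f ((b ⊗ₜ c) * s) = c * leftSlice (f ∘ₗ LinearMap.mulLeft k b) s := by
  induction s with
  | zero => simp
  | tmul u v => simp
  | add s t hs ht => simp only [mul_add, map_add, hs, ht]

/-- Sweedler calculus modulo `P`: since `Δ(a) ∈ K ⊗ K`, two linear expressions in `a₁ ⊗ a₂` need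
only be compared on pure tensors from `K`. -/
lemma mul_comul_mem {A : Type*} [AddCommGroup A] [Module k A] {K : Subalgebra k H}
    (hK : IsSubcoalgebra k (Subalgebra.toSubmodule K)) {a : H} (ha : a ∈ K)
    (F G : H ⊗[k] H →ₗ[k] A) (P : Submodule k A)
    (h : ∀ b ∈ K, ∀ c ∈ K, F (b ⊗ₜ c) - G (b ⊗ₜ c) ∈ P) :
    F (comul a) - G (comul a) ∈ P :=
  range_mapIncl_induction (p := fun t ↦ F t - G t ∈ P) (by simp) h
    (fun s t hs ht ↦ by simpa [add_sub_add_comm] using P.add_mem hs ht) (hK a ha)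

/-- The annihilator `N` of `x` modulo `M` in `K` is closed under left hits, because `Δ(ax) ≡ a₁g ⊗
a₂x` and `g` is invertible. The counit vanishes on `N`, and `f(a) = ε(f(a₁) a₂)` then makes every
functional vanish on `N`. -/
lemma eq_zero_of_mul_mem_leftCoideal {K : Subalgebra k H} (hK : IsHopfSubalgebra K)
    (M : Submodule (hitAlgebra k H) H) (hKM : ∀ a ∈ K, ∀ m ∈ M, a * m ∈ M) {x : H} (hx : x ∉ M)
    {g : H} (hg : IsGroupLikeElem k g) (hgx : ∀ f, leftHit k H f x - f g • x ∈ M)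
    {a : H} (ha : a ∈ K) (hax : a * x ∈ M) : a = 0 := by
  let M' := M.restrictScalars k
  let N : Submodule k H := Subalgebra.toSubmodule K ⊓ M'.comap (LinearMap.mulRight k x)
  have hNl : ∀ a ∈ N, ∀ f, leftHit k H f a ∈ N := by
    rintro a ⟨haK, hax⟩ f
    refine ⟨hK.isSubcoalgebra.leftHit_mem f haK, ?_⟩
    -- Chosen so that `f'(bg) = f(b)`, cancelling the factor `g`.
    let f' : Module.Dual k H := f ∘ₗ LinearMap.mulRight k (antipode k g)
    have h1 : leftHit k H f' (a * x) ∈ M' := leftHit_mem_of_mem M f' hax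
    have h2 := mul_comul_mem hK.isSubcoalgebra haK
      (leftSlice f' ∘ₗ LinearMap.mulRight k (comul x)) (LinearMap.mulRight k x ∘ₗ leftSlice f) M'
      fun b _ c hc ↦ by
        have h3 := hKM c hc _ (hgx (f' ∘ₗ LinearMap.mulLeft k b))
        have h4 : b * g * antipode k g = b := by
          rw [mul_assoc, hg.mul_antipode_cancel, mul_one]
        simpa [leftSlice_tmul_mul, leftHit_apply, mul_sub, f', h4, M'] using h3
    have h5 := M'.sub_mem h1 h2
    simpa [leftHit_apply] using h5
  have hNε : ∀ a ∈ N, counit (R := k) a = 0 := fun a ha ↦ by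
    by_contra h0
    have h1 : comul a ∈ LinearMap.range (TensorProduct.mapIncl (Subalgebra.toSubmodule K) N) :=
      mem_range_mapIncl_iff.2 ⟨hNl a ha, fun φ ↦ hK.isSubcoalgebra.rightHit_mem φ ha.1⟩
    -- `ε(a) x = S(a₁) a₂ x`, with `S(a₁) ∈ K` and `a₂ ∈ N`.
    have h2 : LinearMap.mul' k H ((antipode k).rTensor H (comul a)) * x ∈ M' := by
      refine range_mapIncl_induction
        (p := fun t ↦ LinearMap.mul' k H ((antipode k).rTensor H t) * x ∈ M) (by simp) ?_ ?_ h1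
      · rintro b hb c ⟨-, hc⟩
        simpa [mul_assoc] using hKM _ (hK.antipode_mem b hb) _ hc
      · intro s t hs ht
        simpa [add_mul] using M.add_mem hs ht
    rw [mul_antipode_rTensor_comul_apply, ← Algebra.smul_def] at h2
    have h3 := M'.smul_mem (counit (R := k) a)⁻¹ h2
    rw [inv_smul_smul₀ h0] at h3
    exact hx h3
  rw [← Module.forall_dual_apply_eq_zero_iff k]
  intro f
  rw [← counit_leftHit]
  exact hNε _ (hNl a ⟨ha, hax⟩ f)

lemma mem_span_one_iff {K : Subalgebra k H} {x : H} :
    x ∈ Submodule.span K {(1 : H)} ↔ x ∈ K := by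
  rw [Submodule.mem_span_singleton]
  constructor
  · rintro ⟨a, rfl⟩
    simp [Subalgebra.smul_def]
  · exact fun hx ↦ ⟨⟨x, hx⟩, by simp [Subalgebra.smul_def]⟩

lemma IsPointedCoalgebra.exists_isCompl (hH : IsPointedCoalgebra k H) {K : Subalgebra k H}
    (hK : IsHopfSubalgebra K) :
    ∃ N : Submodule K H, IsCompl (Submodule.span K {(1 : H)}) N := by
  let O : Submodule K H := Submodule.span K {(1 : H)}
  -- Candidates meet `K` trivially and have `N + K` a left coideal; `N` itself need not be one.
  let S : Set (Submodule K H) :=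
    {N | (∀ a ∈ K, a ∈ N → a = 0) ∧ ∀ f : Module.Dual k H, ∀ n ∈ N, leftHit k H f n ∈ N ⊔ O}
  obtain ⟨N, ⟨hN0, hNl⟩, hmax⟩ := zorn_le₀ S fun c hc hchain ↦ by
    obtain rfl | hne := c.eq_empty_or_nonempty
    · refine ⟨⊥, ⟨by simp, ?_⟩, by simp⟩
      rintro f n hn
      rw [(Submodule.mem_bot _).1 hn, map_zero]
      exact zero_mem _
    · have hmem {x : H} := Submodule.mem_sSup_of_directed (z := x) hne hchain.directedOn
      refine ⟨sSup c, ⟨fun a ha haN ↦ ?_, fun f n hn ↦ ?_⟩, fun z hz ↦ le_sSup hz⟩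
      · obtain ⟨N, hN, haN⟩ := hmem.1 haN
        exact (hc hN).1 a ha haN
      · obtain ⟨N, hN, hnN⟩ := hmem.1 hn
        exact sup_le_sup_right (le_sSup hN) O ((hc hN).2 f n hnN)
  have hlO : ∀ f : Module.Dual k H, ∀ n ∈ O, leftHit k H f n ∈ O := fun f n hn ↦
    mem_span_one_iff.2 (hK.isSubcoalgebra.leftHit_mem f (mem_span_one_iff.1 hn))
  have hl : ∀ f : Module.Dual k H, ∀ n ∈ N ⊔ O, leftHit k H f n ∈ N ⊔ O := fun f n hn ↦ by
    obtain ⟨u, hu, v, hv, rfl⟩ := Submodule.mem_sup.1 hn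
    rw [map_add]
    exact add_mem (hNl f u hu) (Submodule.mem_sup_right (hlO f v hv))
  let M := leftCoideal ((N ⊔ O).restrictScalars k) hl
  refine ⟨N, Submodule.disjoint_def.2 fun x hx hxN ↦ hN0 x (mem_span_one_iff.1 hx) hxN,
    codisjoint_iff.2 ?_⟩
  rw [sup_comm]
  by_contra htop
  have hM : ¬ (⊤ : Submodule (hitAlgebra k H) H) ≤ M := fun h ↦
    htop (eq_top_iff.2 fun x _ ↦ (h (Submodule.mem_top (x := x)) : x ∈ M))
  obtain ⟨x, -, hx, g, hg, hgx⟩ := hH.exists_leftHit_sub_smul_mem M ⊤ hM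
  have hKM : ∀ a ∈ K, ∀ m ∈ M, a * m ∈ M := fun a ha m hm ↦
    (N ⊔ O).smul_mem (⟨a, ha⟩ : K) hm
  -- Freeness of `Kx` modulo `N + K` keeps `N'` disjoint from `K`; `Δ(x) ≡ g ⊗ x` keeps `N' + K` a
  -- left coideal.
  let N' := N ⊔ Submodule.span K {x}
  have hxN' : x ∈ N' := Submodule.mem_sup_right (Submodule.mem_span_singleton_self x)
  have hN' : N' ∈ S := by
    constructor
    · intro a ha haN
      obtain ⟨n, hn, y, hy, rfl⟩ := Submodule.mem_sup.1 haN
      obtain ⟨⟨b, hb⟩, rfl⟩ := Submodule.mem_span_singleton.1 hy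
      have hbx : b * x ∈ M := by
        have h : (n + b * x) - n ∈ N ⊔ O := sub_mem
          (Submodule.mem_sup_right (mem_span_one_iff.2 ha)) (Submodule.mem_sup_left hn)
        rwa [add_sub_cancel_left] at h
      have hb0 := eq_zero_of_mul_mem_leftCoideal hK M hKM hx hg hgx hb hbx
      subst hb0
      simp only [Subalgebra.smul_def, smul_eq_mul, zero_mul, add_zero] at ha ⊢
      exact hN0 n ha hn
    · intro f z hz
      obtain ⟨n, hn, y, hy, rfl⟩ := Submodule.mem_sup.1 hz
      obtain ⟨⟨b, hb⟩, rfl⟩ := Submodule.mem_span_singleton.1 hy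
      have hle : N ⊔ O ≤ N' ⊔ O := sup_le_sup_right le_sup_left O
      rw [map_add]
      refine add_mem (hle (hNl f n hn)) ?_
      have h1 := mul_comul_mem hK.isSubcoalgebra hb
        (leftSlice f ∘ₗ LinearMap.mulRight k (comul x)) 0 ((N' ⊔ O).restrictScalars k)
        fun c _ d hd ↦ by
          have h2 : leftHit k H (f ∘ₗ LinearMap.mulLeft k c) x ∈ (N' ⊔ O).restrictScalars k := by
            rw [← sub_add_cancel (leftHit k H _ x)
              ((f ∘ₗ LinearMap.mulLeft k c) g • x)]
            exact add_mem (hle (hgx _)) (Submodule.smul_mem _ _ (Submodule.mem_sup_left hxN'))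
          have h3 := (N' ⊔ O).smul_mem (⟨d, hd⟩ : K) h2
          simpa [leftSlice_tmul_mul, leftHit_apply, Subalgebra.smul_def,
            -Submodule.restrictScalars_sup] using h3
      simpa [leftHit_apply, Subalgebra.smul_def, -Submodule.restrictScalars_sup] using h1
  exact hx (Submodule.mem_sup_left (hmax hN' le_sup_left hxN'))

/-- A Hopf subalgebra of a pointed Hopf algebra is a direct summand as a left module. -/
theorem IsPointedCoalgebra.exists_retraction (hH : IsPointedCoalgebra k H) {K : Subalgebra k H}
    (hK : IsHopfSubalgebra K) :
    ∃ p : H →ₗ[k] H, (∀ x, p x ∈ K) ∧ p 1 = 1 ∧ ∀ a ∈ K, ∀ x, p (a * x) = a * p x := by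
  obtain ⟨N, hN⟩ := hH.exists_isCompl hK
  let q : H →ₗ[K] H := Submodule.subtype _ ∘ₗ Submodule.projectionOnto _ N hN
  refine ⟨q.restrictScalars k, fun x ↦ mem_span_one_iff.1 (Subtype.prop _), ?_, fun a ha x ↦ ?_⟩
  · exact congrArg Subtype.val (Submodule.projectionOnto_apply_left hN
      ⟨1, Submodule.mem_span_singleton_self 1⟩)
  · exact q.map_smul (⟨a, ha⟩ : K) x

end Retraction

/-! ### Recovering a Hopf subalgebra from its augmentation ideals. -/

section Descent

open Coalgebra HopfAlgebra

variable {k H : Type*} [Field k] [Ring H] [HopfAlgebra k H]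

/-- The map `y ↦ S(y₁) p(y₂)`. -/
noncomputable def antipodeConv (p : H →ₗ[k] H) : H →ₗ[k] H :=
  LinearMap.mul' k H ∘ₗ TensorProduct.map (antipode k) p ∘ₗ comul

lemma antipodeConv_one {p : H →ₗ[k] H} (h1 : p 1 = 1) : antipodeConv p 1 = 1 := by
  simp [antipodeConv, Algebra.TensorProduct.one_def, h1]

/-- `S(a₁x₁) p(a₂x₂) = S(x₁) S(a₁) a₂ p(x₂)`; hence `antipodeConv p` kills `K⁺H`. -/
lemma antipodeConv_mul {K : Subalgebra k H} (hK : IsHopfSubalgebra K) {p : H →ₗ[k] H}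
    (hp : ∀ a ∈ K, ∀ x, p (a * x) = a * p x) {a : H} (ha : a ∈ K) (x : H) :
    antipodeConv p (a * x) = counit (R := k) a • antipodeConv p x := by
  have h : ∀ s : H ⊗[k] H, LinearMap.mul' k H (TensorProduct.map (antipode k) p (comul a * s)) =
      counit (R := k) a • LinearMap.mul' k H (TensorProduct.map (antipode k) p s) := fun s ↦ by
    induction s with
    | zero => simp
    | add s t hs ht => simp only [mul_add, map_add, smul_add, hs, ht]
    | tmul c d =>
      have h1 := mul_comul_mem hK.isSubcoalgebra ha
        (LinearMap.mul' k H ∘ₗ TensorProduct.map (antipode k) p ∘ₗ LinearMap.mulRight k (c ⊗ₜ d))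
        (LinearMap.mulRight k (p d) ∘ₗ LinearMap.mulLeft k (antipode k c) ∘ₗ
          LinearMap.mul' k H ∘ₗ (antipode k).rTensor H) ⊥
        fun u _ v hv ↦ by
          simp [antipode_mul_antidistrib, hp v hv, mul_assoc]
      rw [Submodule.mem_bot, sub_eq_zero] at h1
      simp only [LinearMap.comp_apply, LinearMap.mulRight_apply, LinearMap.mulLeft_apply] at h1
      rw [h1, mul_antipode_rTensor_comul_apply, ← Algebra.commutes, ← Algebra.smul_def]
      simp
  simpa [antipodeConv] using h (comul x)

/-- `x₁ S(x₂) p(x₃) = p(x)`: convolving with the identity undoes the antipode. -/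
lemma mul_lTensor_antipodeConv_comul (p : H →ₗ[k] H) (x : H) :
    LinearMap.mul' k H ((antipodeConv p).lTensor H (comul x)) = p x := by
  let T : H ⊗[k] (H ⊗[k] H) →ₗ[k] H :=
    LinearMap.mul' k H ∘ₗ (LinearMap.mul' k H ∘ₗ TensorProduct.map (antipode k) p).lTensor H
  have h1 : ∀ t : H ⊗[k] H, T (TensorProduct.assoc k H H H (comul.rTensor H t)) =
      p (leftSlice counit t) := fun t ↦ by
    induction t with
    | zero => simp
    | add s t hs ht => simp only [map_add, hs, ht]
    | tmul u v =>
      have h2 : ∀ s : H ⊗[k] H, T (TensorProduct.assoc k H H H (s ⊗ₜ v)) =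
          LinearMap.mul' k H ((antipode k).lTensor H s) * p v := fun s ↦ by
        induction s with
        | zero => simp
        | add s t hs ht => simp only [TensorProduct.add_tmul, map_add, add_mul, hs, ht]
        | tmul a b => simp [T, mul_assoc]
      rw [LinearMap.rTensor_tmul, h2, mul_antipode_lTensor_comul_apply, ← Algebra.smul_def,
        leftSlice_tmul, map_smul]
  have h3 : ∀ t : H ⊗[k] H, LinearMap.mul' k H ((antipodeConv p).lTensor H t) =
      T (comul.lTensor H t) := fun t ↦ by
    induction t with
    | zero => simp
    | add s t hs ht => simp only [map_add, hs, ht]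
    | tmul u v => simp [T, antipodeConv]
  rw [h3, ← coassoc_apply, h1, ← leftHit_apply, leftHit_counit]

lemma eq_retraction_of_antipodeConv {L : Submodule k H} (hL : IsSubcoalgebra k L) {p : H →ₗ[k] H}
    (h : ∀ y ∈ L, antipodeConv p y = counit (R := k) y • 1) {x : H} (hx : x ∈ L) : p x = x := by
  rw [← mul_lTensor_antipodeConv_comul p x]
  conv_rhs => rw [← rightHit_counit (k := k) x, rightHit_apply]
  refine range_mapIncl_induction (p := fun t ↦ LinearMap.mul' k H ((antipodeConv p).lTensor H t) =
    rightSlice counit t) (by simp) (fun m _ n hn ↦ by simp [h n hn]) (fun s t hs ht ↦ ?_) (hL x hx)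
  simp only [map_add, hs, ht]

/-- The map `y ↦ (a ↦ y₁ p(S(y₂) a))`. -/
noncomputable def convAntipode (p : H →ₗ[k] H) : H →ₗ[k] Module.End k H :=
  LinearMap.mul' k (Module.End k H) ∘ₗ
    TensorProduct.map (Algebra.lmul k H).toLinearMap
      (LinearMap.mulLeft k (p : Module.End k H) ∘ₗ (Algebra.lmul k H).toLinearMap ∘ₗ antipode k) ∘ₗ
    comul

lemma convAntipode_one (p : H →ₗ[k] H) : convAntipode p 1 = p := by
  ext
  simp [convAntipode, Algebra.TensorProduct.one_def]

/-- `p` is only left `K`-linear, but `S(x₂a₂) = S(a₂) S(x₂)` brings `S(a₂) ∈ K` to the left, where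
it leaves `p` and cancels against `a₁`. Hence `convAntipode p` kills `HK⁺`. -/
lemma convAntipode_mul {K : Subalgebra k H} (hK : IsHopfSubalgebra K) {p : H →ₗ[k] H}
    (hp : ∀ a ∈ K, ∀ x, p (a * x) = a * p x) {a : H} (ha : a ∈ K) (x : H) :
    convAntipode p (x * a) = counit (R := k) a • convAntipode p x := by
  let T : H ⊗[k] H →ₗ[k] Module.End k H := LinearMap.mul' k (Module.End k H) ∘ₗ
    TensorProduct.map (Algebra.lmul k H).toLinearMap
      (LinearMap.mulLeft k (p : Module.End k H) ∘ₗ (Algebra.lmul k H).toLinearMap ∘ₗ antipode k)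
  have hT : ∀ u v z, T (u ⊗ₜ v) z = u * p (antipode k v * z) := fun u v z ↦ by simp [T]
  have h : ∀ s : H ⊗[k] H, T (s * comul a) = counit (R := k) a • T s := fun s ↦ by
    induction s with
    | zero => simp
    | add s t hs ht => simp only [add_mul, map_add, smul_add, hs, ht]
    | tmul c d =>
      ext z
      have h1 := mul_comul_mem hK.isSubcoalgebra ha
        (LinearMap.applyₗ z ∘ₗ T ∘ₗ LinearMap.mulLeft k (c ⊗ₜ d))
        (LinearMap.mulRight k (p (antipode k d * z)) ∘ₗ LinearMap.mulLeft k c ∘ₗ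
          LinearMap.mul' k H ∘ₗ (antipode k).lTensor H) ⊥
        fun u _ v hv ↦ by
          simp [hT, antipode_mul_antidistrib, hp _ (hK.antipode_mem v hv), mul_assoc]
      rw [Submodule.mem_bot, sub_eq_zero] at h1
      simp only [LinearMap.comp_apply, LinearMap.mulRight_apply, LinearMap.mulLeft_apply,
        LinearMap.applyₗ_apply_apply] at h1
      rw [h1, mul_antipode_lTensor_comul_apply, ← Algebra.commutes, ← Algebra.smul_def,
        smul_mul_assoc, LinearMap.smul_apply, hT]
  have h2 := h (comul x)
  rw [← Bialgebra.comul_mul] at h2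
  exact h2

/-- `x₁ p(S(x₂) x₃) = x₁ ε(x₂) p(1) = x`. The free argument of `convAntipode` is there to receive
`x₃`. -/
lemma lift_convAntipode_comul {p : H →ₗ[k] H} (h1 : p 1 = 1) (x : H) :
    TensorProduct.lift (convAntipode p) (comul x) = x := by
  let q : H ⊗[k] H →ₗ[k] H := p ∘ₗ LinearMap.mul' k H ∘ₗ (antipode k).rTensor H
  let T : H ⊗[k] (H ⊗[k] H) →ₗ[k] H := LinearMap.mul' k H ∘ₗ q.lTensor H
  have h2 : ∀ t : H ⊗[k] H, TensorProduct.lift (convAntipode p) t =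
      T (TensorProduct.assoc k H H H (comul.rTensor H t)) := fun t ↦ by
    induction t with
    | zero => simp
    | add s t hs ht => simp only [map_add, hs, ht]
    | tmul u v =>
      rw [LinearMap.rTensor_tmul, TensorProduct.lift.tmul, convAntipode, LinearMap.comp_apply,
        LinearMap.comp_apply]
      induction comul (R := k) u with
      | zero => simp
      | add s t hs ht =>
        simp only [TensorProduct.add_tmul, map_add, LinearMap.add_apply, hs, ht]
      | tmul a b => simp [T, q]
  have h3 : ∀ t : H ⊗[k] H, T (comul.lTensor H t) = rightSlice counit t := fun t ↦ by
    induction t with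
    | zero => simp
    | add s t hs ht => simp only [map_add, hs, ht]
    | tmul u v =>
      simp [T, q, mul_antipode_rTensor_comul_apply, Algebra.algebraMap_eq_smul_one, h1]
  rw [h2, coassoc_apply, h3, ← rightHit_apply, rightHit_counit]

lemma eq_retraction_of_convAntipode {L : Submodule k H} (hL : IsSubcoalgebra k L) {p : H →ₗ[k] H}
    (h1 : p 1 = 1) (h : ∀ y ∈ L, convAntipode p y = counit (R := k) y • p) {x : H} (hx : x ∈ L) :
    p x = x := by
  conv_rhs => rw [← lift_convAntipode_comul h1 x]
  conv_lhs => rw [← leftHit_counit (k := k) x, leftHit_apply]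
  refine range_mapIncl_induction (p := fun t ↦ p (leftSlice counit t) =
    TensorProduct.lift (convAntipode p) t) (by simp) (fun m hm n _ ↦ by simp [h m hm])
    (fun s t hs ht ↦ ?_) (hL x hx)
  simp only [map_add, hs, ht]

variable (k) in
/-- The right ideal `K⁺H`. -/
def augRightIdeal (K : Subalgebra k H) : Ideal Hᵐᵒᵖ :=
  Ideal.span {y | y.unop ∈ K ∧ counit (R := k) y.unop = 0}

variable (k) in
/-- The left ideal `HK⁺`. -/
def augLeftIdeal (K : Subalgebra k H) : Ideal H :=
  Ideal.span {y | y ∈ K ∧ counit (R := k) y = 0}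

lemma sub_counit_mem {K : Subalgebra k H} {y : H} (hy : y ∈ K) :
    y - counit (R := k) y • 1 ∈ K ∧ counit (R := k) (y - counit (R := k) y • (1 : H)) = 0 :=
  ⟨sub_mem hy (K.smul_mem K.one_mem _), by simp⟩

/-- A Hopf subalgebra `K` of a pointed Hopf algebra is determined by `K⁺H`. -/
theorem IsPointedCoalgebra.le_of_augRightIdeal_le (hH : IsPointedCoalgebra k H)
    {K L : Subalgebra k H} (hK : IsHopfSubalgebra K) (hL : IsHopfSubalgebra L)
    (h : augRightIdeal k L ≤ augRightIdeal k K) : L ≤ K := by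
  obtain ⟨p, hpK, h1, hp⟩ := hH.exists_retraction hK
  -- The extra factor `r` lets the induction absorb multiplication by elements of `H`.
  have hker : ∀ z ∈ augRightIdeal k K, ∀ r, antipodeConv p (z.unop * r) = 0 := fun z hz ↦ by
    induction hz using Submodule.span_induction with
    | mem z hz => exact fun r ↦ by rw [antipodeConv_mul hK hp hz.1, hz.2, zero_smul]
    | zero => simp
    | add y z _ _ hy hz => exact fun r ↦ by simp [add_mul, hy r, hz r]
    | smul a y _ hy => exact fun r ↦ by simpa [mul_assoc] using hy (a.unop * r)
  intro x hx
  rw [← eq_retraction_of_antipodeConv hL.isSubcoalgebra (p := p) (fun y hy ↦ ?_) hx]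
  · exact hpK x
  · have h2 := hker (.op (y - counit (R := k) y • 1))
      (h (Ideal.subset_span (sub_counit_mem hy))) 1
    simpa [sub_eq_zero, antipodeConv_one h1] using h2

/-- A Hopf subalgebra `K` of a pointed Hopf algebra is determined by `HK⁺`. -/
theorem IsPointedCoalgebra.le_of_augLeftIdeal_le (hH : IsPointedCoalgebra k H)
    {K L : Subalgebra k H} (hK : IsHopfSubalgebra K) (hL : IsHopfSubalgebra L)
    (h : augLeftIdeal k L ≤ augLeftIdeal k K) : L ≤ K := by
  obtain ⟨p, hpK, h1, hp⟩ := hH.exists_retraction hK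
  have hker : ∀ z ∈ augLeftIdeal k K, ∀ r, convAntipode p (r * z) = 0 := fun z hz ↦ by
    induction hz using Submodule.span_induction with
    | mem z hz => exact fun r ↦ by rw [convAntipode_mul hK hp hz.1, hz.2, zero_smul]
    | zero => simp
    | add y z _ _ hy hz => exact fun r ↦ by simp [mul_add, hy r, hz r]
    | smul a y _ hy => exact fun r ↦ by simpa [mul_assoc] using hy (r * a)
  intro x hx
  rw [← eq_retraction_of_convAntipode hL.isSubcoalgebra h1 (fun y hy ↦ ?_) hx]
  · exact hpK x
  · have h2 := hker (y - counit (R := k) y • 1) (h (Ideal.subset_span (sub_counit_mem hy))) 1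
    simpa [sub_eq_zero, convAntipode_one] using h2

theorem IsPointedCoalgebra.hopfSubalgebrasACC_of_isNoetherianRing (hH : IsPointedCoalgebra k H)
    (h : IsNoetherianRing Hᵐᵒᵖ ∨ IsNoetherianRing H) : HopfSubalgebrasACC k H := by
  intro K hK hmono
  obtain h | h := h
  · obtain ⟨N, hN⟩ := monotone_stabilizes_iff_noetherian.2 h
      ⟨fun n ↦ augRightIdeal k (K n), fun m n hmn ↦
        Ideal.span_mono fun y hy ↦ ⟨hmono hmn hy.1, hy.2⟩⟩
    exact ⟨N, fun n hn ↦ le_antisymm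
      (hH.le_of_augRightIdeal_le (hK N) (hK n) (hN n hn).ge) (hmono hn)⟩
  · obtain ⟨N, hN⟩ := monotone_stabilizes_iff_noetherian.2 h
      ⟨fun n ↦ augLeftIdeal k (K n), fun m n hmn ↦
        Ideal.span_mono fun y hy ↦ ⟨hmono hmn hy.1, hy.2⟩⟩
    exact ⟨N, fun n hn ↦ le_antisymm
      (hH.le_of_augLeftIdeal_le (hK N) (hK n) (hN n hn).ge) (hmono hn)⟩

end Descent

/-! ### Affine Hopf subalgebras and chains. -/

section Generation

open Coalgebra HopfAlgebra

variable {k H : Type*} [Field k] [Ring H] [HopfAlgebra k H]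

/-- `Δ` is an algebra map and `B ⊗ B` has a subalgebra as image, so generators suffice. -/
lemma isSubcoalgebra_adjoin {s : Set H}
    (h : ∀ x ∈ s, comul (R := k) x ∈ LinearMap.range (TensorProduct.mapIncl
      (Subalgebra.toSubmodule (Algebra.adjoin k s)) (Subalgebra.toSubmodule (Algebra.adjoin k s)))) :
    IsSubcoalgebra k (Subalgebra.toSubmodule (Algebra.adjoin k s)) := by
  let B := Algebra.adjoin k s
  let R : Subalgebra k (H ⊗[k] H) := (Algebra.TensorProduct.map B.val B.val).range
  have hle : Algebra.adjoin k s ≤ R.comap (Bialgebra.comulAlgHom k H) :=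
    Algebra.adjoin_le fun x hx ↦ h x hx
  exact fun x hx ↦ hle hx

lemma antipode_mem_of_mem_adjoin {s : Set H} {B : Subalgebra k H}
    (h : ∀ x ∈ s, antipode k x ∈ B) {x : H} (hx : x ∈ Algebra.adjoin k s) :
    antipode k x ∈ B := by
  induction hx using Algebra.adjoin_induction with
  | mem x hx => exact h x hx
  | algebraMap r => simpa [Algebra.algebraMap_eq_smul_one] using B.smul_mem B.one_mem r
  | add x y _ _ hx hy => simpa using B.add_mem hx hy
  | mul x y _ _ hx hy => simpa [antipode_mul_antidistrib] using B.mul_mem hy hx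

lemma IsHopfSubalgebra.sup {K L : Subalgebra k H} (hK : IsHopfSubalgebra K)
    (hL : IsHopfSubalgebra L) : IsHopfSubalgebra (K ⊔ L) := by
  have hKle : K ≤ Algebra.adjoin k (K ∪ L : Set H) := fun x hx ↦ Algebra.subset_adjoin (.inl hx)
  have hLle : L ≤ Algebra.adjoin k (K ∪ L : Set H) := fun x hx ↦ Algebra.subset_adjoin (.inr hx)
  rw [Algebra.sup_def]
  refine ⟨isSubcoalgebra_adjoin ?_, fun x hx ↦ antipode_mem_of_mem_adjoin ?_ hx⟩
  · rintro x (hx | hx)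
    · exact range_mapIncl_mono hKle hKle (hK.isSubcoalgebra x hx)
    · exact range_mapIncl_mono hLle hLle (hL.isSubcoalgebra x hx)
  · rintro x (hx | hx)
    · exact hKle (hK.antipode_mem x hx)
    · exact hLle (hL.antipode_mem x hx)

lemma isHopfSubalgebra_iSup {K : ℕ → Subalgebra k H} (hK : ∀ n, IsHopfSubalgebra (K n))
    (hmono : Monotone K) : IsHopfSubalgebra (⨆ n, K n) := by
  have hmem {x : H} : x ∈ ⨆ n, K n ↔ ∃ n, x ∈ K n := by
    rw [← SetLike.mem_coe, Subalgebra.coe_iSup_of_directed hmono.directed_le, Set.mem_iUnion]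
    rfl
  refine ⟨fun x hx ↦ ?_, fun x hx ↦ ?_⟩
  · obtain ⟨n, hn⟩ := hmem.1 hx
    exact range_mapIncl_mono (le_iSup K n) (le_iSup K n) ((hK n).isSubcoalgebra x hn)
  · obtain ⟨n, hn⟩ := hmem.1 hx
    exact hmem.2 ⟨n, (hK n).antipode_mem x hn⟩

/-- In a pointed Hopf algebra, the antipode maps a subcoalgebra `D` into every subalgebra
containing `D` and the inverses of its group-like elements. -/
theorem IsPointedCoalgebra.antipode_mem_of_isSubcoalgebra (hH : IsPointedCoalgebra k H)
    {D : Submodule k H} (hD : IsSubcoalgebra k D) {B : Subalgebra k H}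
    (hDB : ∀ x ∈ D, x ∈ B) (hgB : ∀ g ∈ D, IsGroupLikeElem k g → antipode k g ∈ B)
    {x : H} (hx : x ∈ D) : antipode k x ∈ B := by
  -- The elements all of whose left hits are sent into `B` by the antipode: a left coideal, so the
  -- socle argument applies to `D` modulo `N`.
  let N : Submodule k H :=
    ⨅ f : Module.Dual k H, (Subalgebra.toSubmodule B).comap (antipode k ∘ₗ leftHit k H f)
  have hN {y : H} : y ∈ N ↔ ∀ f : Module.Dual k H, antipode k (leftHit k H f y) ∈ B := by
    simp [N]
  have hNS {y : H} (hy : y ∈ N) : antipode k y ∈ B := by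
    simpa using hN.1 hy counit
  let M := leftCoideal N fun f y hy ↦ hN.2 fun g ↦ by
    rw [leftHit_leftHit]
    exact hN.1 hy _
  suffices h : leftCoideal D (fun f y hy ↦ hD.leftHit_mem f hy) ≤ M from hNS (h hx)
  by_contra hle
  obtain ⟨x, hxD, hxM, g, hg, hgx⟩ := hH.exists_leftHit_sub_smul_mem M _ hle
  rw [mem_leftCoideal] at hxD
  -- A functional `φ` vanishing on `N` gives `x₁ φ(x₂) = φ(x) g`.
  have hgD : g ∈ D := by
    obtain ⟨φ, hφx, hφ⟩ := exists_dual_vanishing_of_notMem M hxM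
    have h1 : rightHit k H φ x = φ x • g := by
      rw [← sub_eq_zero, ← Module.forall_dual_apply_eq_zero_iff k]
      intro f
      have h2 := hφ _ (hgx f)
      rw [map_sub, apply_leftHit, map_smul] at h2
      simpa [mul_comm] using h2
    have h3 := D.smul_mem (φ x)⁻¹ (hD.rightHit_mem φ hxD)
    rwa [h1, inv_smul_smul₀ hφx] at h3
  have ht : comul x - g ⊗ₜ[k] x ∈ LinearMap.range (TensorProduct.mapIncl D N) := by
    refine mem_range_mapIncl_iff.2 ⟨fun f ↦ ?_, fun φ ↦ ?_⟩
    · rw [map_sub, leftSlice_tmul]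
      exact hgx f
    · simpa [rightHit_apply] using D.sub_mem (hD.rightHit_mem φ hxD) (D.smul_mem (φ x) hgD)
  -- Applying `c ⊗ n ↦ c S(n)` to `Δ(x) - g ⊗ x` gives `ε(x) - g S(x)`, whence `S(x) ∈ B`.
  have h1 : LinearMap.mul' k H ((antipode k).lTensor H (comul x - g ⊗ₜ[k] x)) ∈ B :=
    range_mapIncl_induction (p := fun t ↦ LinearMap.mul' k H ((antipode k).lTensor H t) ∈ B)
      (by simp) (fun c hc n hn ↦ by simpa using B.mul_mem (hDB c hc) (hNS hn))
      (fun s t hs ht ↦ by simpa using B.add_mem hs ht) ht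
  rw [map_sub, map_sub, mul_antipode_lTensor_comul_apply] at h1
  have h2 : g * antipode k x ∈ B := by
    have := B.sub_mem (B.algebraMap_mem (counit x)) h1
    simpa using this
  have hxB : antipode k x ∈ B := by
    have := B.mul_mem (hgB g hgD hg) h2
    rwa [← mul_assoc, hg.antipode_mul_cancel, one_mul] at this
  refine hxM (hN.2 fun f ↦ ?_)
  rw [← sub_add_cancel (leftHit k H f x) (f g • x), map_add, map_smul]
  exact B.add_mem (hNS (hgx f)) (B.smul_mem hxB _)

/-- Distinct group-likes are linearly independent. -/
lemma finite_setOf_isGroupLikeElem_mem (D : Submodule k H) [Module.Finite k D] :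
    {g | g ∈ D ∧ IsGroupLikeElem k g}.Finite := by
  have h : LinearIndependent k
      (fun g : {g | g ∈ D ∧ IsGroupLikeElem k g} ↦ (⟨g, g.2.1⟩ : D)) := by
    refine LinearIndependent.of_comp D.subtype ?_
    exact (linearIndepOn_isGroupLikeElem (R := k) (A := H)).mono fun g hg ↦ hg.2
  exact h.finite

/-- Every element of a Hopf subalgebra `K` of a pointed Hopf algebra lies in an affine Hopf
subalgebra of `K`. -/
theorem IsPointedCoalgebra.exists_fg_hopfSubalgebra (hH : IsPointedCoalgebra k H)
    {K : Subalgebra k H} (hK : IsHopfSubalgebra K) {x : H} (hx : x ∈ K) :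
    ∃ B : Subalgebra k H, IsHopfSubalgebra B ∧ B.FG ∧ B ≤ K ∧ x ∈ B := by
  obtain ⟨D', hD', _, hxD'⟩ := exists_finite_subcoalgebra (k := k) x
  let D : Submodule k H := D' ⊓ Subalgebra.toSubmodule K
  have hD : IsSubcoalgebra k D := isSubcoalgebra_of_hit_mem
    (fun f y hy ↦ ⟨hD'.leftHit_mem f hy.1, hK.isSubcoalgebra.leftHit_mem f hy.2⟩)
    (fun f y hy ↦ ⟨hD'.rightHit_mem f hy.1, hK.isSubcoalgebra.rightHit_mem f hy.2⟩)
  have hDfin : Module.Finite k D := Submodule.finiteDimensional_of_le inf_le_left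
  let G : Set H := {g | g ∈ D ∧ IsGroupLikeElem k g}
  let s : Set H := D ∪ antipode k '' G
  have hDB : ∀ y ∈ D, y ∈ Algebra.adjoin k s := fun y hy ↦ Algebra.subset_adjoin (.inl hy)
  have hGB : ∀ g ∈ G, antipode k g ∈ Algebra.adjoin k s :=
    fun g hg ↦ Algebra.subset_adjoin (.inr ⟨g, hg, rfl⟩)
  refine ⟨Algebra.adjoin k s, ⟨isSubcoalgebra_adjoin ?_, fun y hy ↦
    antipode_mem_of_mem_adjoin ?_ hy⟩, ?_, Algebra.adjoin_le ?_, hDB x ⟨hxD', hx⟩⟩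
  · rintro y (hy | ⟨g, hg, rfl⟩)
    · exact range_mapIncl_mono hDB hDB (hD y hy)
    · rw [hg.2.antipode.comul_eq_tmul_self]
      exact ⟨⟨_, hGB g hg⟩ ⊗ₜ ⟨_, hGB g hg⟩, by simp [TensorProduct.mapIncl]⟩
  · rintro y (hy | ⟨g, hg, rfl⟩)
    · exact hH.antipode_mem_of_isSubcoalgebra hD hDB (fun g hg hg' ↦ hGB g ⟨hg, hg'⟩) hy
    · rw [hg.2.antipode_antipode]
      exact hDB g hg.1
  · rw [Algebra.adjoin_union]
    refine Subalgebra.FG.sup ?_ ?_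
    · obtain ⟨t, ht⟩ := Module.Finite.iff_fg.1 hDfin
      exact ⟨t, by rw [← ht, Algebra.adjoin_span]⟩
    · obtain ⟨t, ht⟩ := ((finite_setOf_isGroupLikeElem_mem D).image (antipode k)).exists_finset_coe
      exact ⟨t, by rw [ht]⟩
  · rintro y (hy | ⟨g, hg, rfl⟩)
    · exact hy.2
    · exact hK.antipode_mem g hg.1.2

theorem IsPointedCoalgebra.hopfSubalgebrasAffine_of_acc (hH : IsPointedCoalgebra k H)
    (hacc : HopfSubalgebrasACC k H) : HopfSubalgebrasAffine k H := by
  intro K hK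
  have hwf : WellFoundedGT {B : Subalgebra k H // IsHopfSubalgebra B} := by
    rw [wellFoundedGT_iff_monotone_chain_condition]
    intro a
    obtain ⟨N, hN⟩ := hacc (fun n ↦ (a n).1) (fun n ↦ (a n).2) a.monotone
    exact ⟨N, fun m hm ↦ Subtype.ext (hN m hm).symm⟩
  obtain ⟨B₀, hB₀, hB₀fg, hB₀K, -⟩ := hH.exists_fg_hopfSubalgebra hK K.one_mem
  obtain ⟨⟨B, hB⟩, ⟨hBfg, hBK⟩, hmax⟩ := hwf.wf.has_min
    {B : {B : Subalgebra k H // IsHopfSubalgebra B} | B.1.FG ∧ B.1 ≤ K}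
    ⟨⟨B₀, hB₀⟩, hB₀fg, hB₀K⟩
  have hKB : K ≤ B := fun x hx ↦ by
    obtain ⟨B', hB', hB'fg, hB'K, hxB'⟩ := hH.exists_fg_hopfSubalgebra hK hx
    by_contra hxB
    refine hmax ⟨B ⊔ B', hB.sup hB'⟩ ⟨hBfg.sup hB'fg, sup_le hBK hB'K⟩ ?_
    exact lt_of_le_not_ge (le_sup_left : B ≤ B ⊔ B') fun h : B ⊔ B' ≤ B ↦
      hxB (h ((le_sup_right : B' ≤ B ⊔ B') hxB'))
  rw [← Subalgebra.fg_iff_finiteType, le_antisymm hKB hBK]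
  exact hBfg

theorem hopfSubalgebrasACC_of_affine (h : HopfSubalgebrasAffine k H) :
    HopfSubalgebrasACC k H := by
  intro K hK hmono
  have hfin := h _ (isHopfSubalgebra_iSup hK hmono)
  obtain ⟨t, ht⟩ := (Subalgebra.fg_iff_finiteType _).2 hfin
  have hN : ∃ N, (t : Set H) ⊆ K N := by
    refine hmono.directed_le.exists_mem_subset_of_finset_subset_biUnion ?_
    rw [← Subalgebra.coe_iSup_of_directed hmono.directed_le, ← ht]
    exact Algebra.subset_adjoin
  obtain ⟨N, hN⟩ := hN
  refine ⟨N, fun n hn ↦ le_antisymm ?_ (hmono hn)⟩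
  exact (le_iSup K n).trans (ht.ge.trans (Algebra.adjoin_le hN))

end Generation

theorem mainTheorem3 {k H : Type*} [Field k] [Ring H] [HopfAlgebra k H]
    (hH : IsPointedCoalgebra k H) :
    (HopfSubalgebrasAffine k H ↔ HopfSubalgebrasACC k H) ∧
    (IsNoetherianRing Hᵐᵒᵖ ∨ IsNoetherianRing H →
      HopfSubalgebrasAffine k H ∧ HopfSubalgebrasACC k H) :=
  ⟨⟨hopfSubalgebrasACC_of_affine, hH.hopfSubalgebrasAffine_of_acc⟩, fun h ↦
    have hacc := hH.hopfSubalgebrasACC_of_isNoetherianRing h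
    ⟨hH.hopfSubalgebrasAffine_of_acc hacc, hacc⟩⟩
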